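/- **Setting.** Let $H$ be an $N$-dimensional complex vector space with a homogeneous basis $\phi_1,\dots,\phi_N$ of half-degrees $p_i=\tfrac12\deg\phi_i$, a non-degenerate symmetric pairing $(\cdot,\cdot)$ with $(\phi_i,\phi_j)=0$ unless $p_i+p_j=d$, a class $c_1\in H$ of half-degree $1$ and a class $1\in H$ of half-degree $0$. Put $\mu\phi_i=(p_i-\tfrac d2)\phi_i$ and $E=c_1+\sum_i(1-p_i)\tau^i\phi_i$ for $\tau=\sum_i\tau^i\phi_i$. Let $B\subset H$ be open and connected, and let $\star_\tau$ ($\tau\in B$) be a holomorphic family of products making $H$ a conformal Frobenius manifold over $B$: each $\star_\tau$ is commutative and associative with unit $1$ and satisfies $(a\star_\tau b,c)=(a,b\star_\tau c)$; moreover $\partial_a(b\star_\tau c)=\partial_b(a\star_\tau c)$, and $\star_\tau$ is homogeneous with respect to $E$. (For a Fano manifold $F$ one takes $H=H^{\rm even}(F;\mathbb C)$, the Poincaré pairing, $d=\dim F$, $c_1=c_1(F)$ and the big quantum product on a region $B$ where it converges.) The associated flat connection is $$\nabla_\alpha=\partial_\alpha+\tfrac1z(\alpha\star_\tau),\qquad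 \nabla_{z\partial_z}=z\partial_z-\tfrac1z(E\star_\tau)+\mu .$$ Suppose $\star_\tau$ is semisimple for $\tau\in B$. Let $\Psi_i=\psi_i/\sqrt{(\psi_i,\psi_i)}$ ($1\le i\le N$) be the normalized idempotents, where $\psi_1,\dots,\psi_N$ is a basis of $H$ with $\psi_i\star_\tau\psi_j=\delta_{ij}\psi_i$, chosen holomorphically in $\tau\in B$, and let $u_i=u_i(\tau)$ be given by $E\star_\tau\Psi_i=u_i\Psi_i$; the $u_i$ may coincide. Let $\tau_0\in B$ and let $\phi\in\mathbb R$ be admissible for $u_1(\tau_0),\dots,u_N(\tau_0)$, i.e. $e^{-\mathtt i\phi}(u_i(\tau_0)-u_j(\tau_0))\notin\mathbb R_{>0}$ for all $i,j$. Let $\epsilon>0$, and let $Y=(y_1,\dots,y_N)$ and $Y^-=(y_1^-,\dots,y_N^-)$ be asymptotically exponential fundamental solutions over $B$ associated to $e^{\mathtt i\phi}$ and $-e^{\mathtt i\phi}$: holomorphic frames of $\nabla$-flat sections, for $\tau\in B$ and $z$ in the sectors $|\arg z-\phi|<\frac\pi2+\epsilon$ and $|\arg z-\phi-\pi|<\frac\pi2+\epsilon$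 respectively, such that $e^{u_i/z}y_i(\tau,z)\to\Psi_i(\tau)$, respectively $e^{u_i/z}y_i^-(\tau,z)\to\Psi_i(\tau)$, as $z\to0$ in the sector, for every $\tau\in B$. Let $\Pi_\pm$ be the sectors $|\arg z-(\phi\pm\frac\pi2)|<\epsilon$, where the two sectors overlap. The Stokes matrices $S=(S_{ij})$ and $S_-=(S_{-,ij})$ are defined by $Y(z)=Y^-(z)S$ for $z\in\Pi_+$ and $Y(z)=Y^-(z)S_-$ for $z\in\Pi_-$ (where in the second formula the value of $Y^-$ at $z$ is taken at the argument $\arg z+2\pi$). **Proposition.** The Stokes matrices $S$, $S_-$ exist, are unique, and do not depend on $\tau\in B$. Moreover: 1. For $\tau\in B$ and $z\in\Pi_+$, $S_{ij}=S_{-,ji}=(y_i(\tau,e^{-\pi\mathtt i}z),y_j(\tau,z))$. The matrix $S$ is invertible, and $(S^{-1})_{ij}=(y^-_i(\tau,e^{\pi\mathtt i}z),y^-_j(\tau,z))$. 2. $S_{ii}=1$ for all $i$; $S_{ij}=0$ if $i\ne j$ and $u_i(\tau)=u_j(\tau)$ for some $\tau\in B$; and $S_{ij}=0$ if $\operatorname{Im}(e^{-\mathtt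 i\phi}u_i(\tau))<\operatorname{Im}(e^{-\mathtt i\phi}u_j(\tau))$ for some $\tau\in B$. In particular, if the indices are ordered so that $\operatorname{Im}(e^{-\mathtt i\phi}u_1(\tau_0))\ge\cdots\ge\operatorname{Im}(e^{-\mathtt i\phi}u_N(\tau_0))$, then $S$ is upper triangular with unit diagonal, i.e. $y_1,\dots,y_N$ are semiorthonormal for the pairing $[s,t)=(s(\tau,e^{-\pi\mathtt i}z),t(\tau,z))$, $z\in\Pi_+$: $[y_i,y_i)=1$ and $[y_i,y_j)=0$ for $i>j$. -/

import Mathlib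

open Filter Topology

noncomputable section

/-- The linear data underlying quantum cohomology: a finite-dimensional complex vector space
`H` (for a Fano manifold `F`, the even cohomology) with a homogeneous basis, half-degrees
(`halfDeg i = p` when the `i`-th basis vector lies in `H^{2p}`), the complex dimension `dim`,
the (Poincare) pairing, the first Chern class `c₁` and the identity class `one`. -/
structure GradedPairedSpace (N : ℕ) (H : Type*) [NormedAddCommGroup H] [NormedSpace ℂ H] where
  homBasis : Module.Basis (Fin N) ℂ H
  halfDeg : Fin N → ℂ
  dim : ℂ
  pairing : LinearMap.BilinForm ℂ H
  pairing_symm : ∀ a b, pairing a b = pairing b a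
  pairing_nondegenerate : ∀ a, (∀ b, pairing a b = 0) → a = 0
  pairing_homogeneous : ∀ i j, halfDeg i + halfDeg j ≠ dim →
    pairing (homBasis i) (homBasis j) = 0
  c₁ : H
  c₁_homogeneous : ∀ i, halfDeg i ≠ 1 → homBasis.repr c₁ i = 0
  one : H
  one_homogeneous : ∀ i, halfDeg i ≠ 0 → homBasis.repr one i = 0

namespace GradedPairedSpace

variable {N : ℕ} {H : Type*} [NormedAddCommGroup H] [NormedSpace ℂ H]

/-- Multiplication by the half-degree: `p` on `H^{2p}`. -/
def deg (G : GradedPairedSpace N H) : H →ₗ[ℂ] H :=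
  G.homBasis.constr ℂ fun i => G.halfDeg i • G.homBasis i

/-- The grading operator `μ`, equal to `p - dim / 2` on `H^{2p}`. -/
def mu (G : GradedPairedSpace N H) : H →ₗ[ℂ] H :=
  G.homBasis.constr ℂ fun i => (G.halfDeg i - G.dim / 2) • G.homBasis i

/-- The Euler vector field `E = c₁ + ∑ᵢ (1 - ½ deg φᵢ) τⁱ φᵢ`. -/
def euler (G : GradedPairedSpace N H) (τ : H) : H :=
  G.c₁ + ∑ i, ((1 - G.halfDeg i) * G.homBasis.repr τ i) • G.homBasis i

end GradedPairedSpace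

/-- A (conformal) Frobenius manifold structure, in flat coordinates, on the domain `B ⊆ H`:
a holomorphic family of products `⋆_τ`, `τ ∈ B`. The big quantum product of a Fano manifold on
a region where it converges is the motivating example. The axioms `integrable` and
`homogeneous` are the flatness of the big quantum connection. -/
structure FrobeniusManifold (N : ℕ) (H : Type*) [NormedAddCommGroup H] [NormedSpace ℂ H]
    (B : Set H) extends GradedPairedSpace N H where
  /-- `mul τ a b = a ⋆_τ b` -/
  mul : H → H →ₗ[ℂ] H →ₗ[ℂ] H
  mul_comm : ∀ τ ∈ B, ∀ a b, mul τ a b = mul τ b a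
  mul_assoc : ∀ τ ∈ B, ∀ a b c, mul τ (mul τ a b) c = mul τ a (mul τ b c)
  one_mul : ∀ τ ∈ B, ∀ a, mul τ one a = a
  pairing_mul : ∀ τ ∈ B, ∀ a b c, pairing (mul τ a b) c = pairing a (mul τ b c)
  mul_holomorphic : ∀ a b, DifferentiableOn ℂ (fun τ => mul τ a b) B
  /-- `∂_a (b ⋆_τ c) = ∂_b (a ⋆_τ c)` -/
  integrable : ∀ τ ∈ B, ∀ a b c,
    fderiv ℂ (fun σ => mul σ b c) τ a = fderiv ℂ (fun σ => mul σ a c) τ b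
  /-- The product is homogeneous of degree zero with respect to the Euler field. -/
  homogeneous : ∀ τ ∈ B, ∀ a b,
    fderiv ℂ (fun σ => mul σ a b) τ (toGradedPairedSpace.euler τ) =
      mul τ (toGradedPairedSpace.deg a) b + mul τ a (toGradedPairedSpace.deg b)
        - toGradedPairedSpace.deg (mul τ a b)

/-- Throughout, a point of the universal cover of `ℂ \ {0}` is given by its logarithm `w`, so
that `z = exp w`, `arg z = Im w`, `z ∂_z = ∂_w`, and `e^{-π i} z` is `w - π i`.
This is the sector `|arg z - φ| < π / 2 + ε`. -/
def logSector (φ ε : ℝ) : Set ℂ := {w | |w.im - φ| < Real.pi / 2 + ε}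

/-- The part `Π₊` of the overlap of the sectors of `Y` (around the phase `φ`) and of `Y⁻`
(around `φ + π`), in terms of the argument used for `Y`. -/
def piPlus (φ ε : ℝ) : Set ℂ := {w | |w.im - (φ + Real.pi / 2)| < ε}

/-- The part `Π₋` of the overlap of the two sectors, in terms of the argument used for `Y`. -/
def piMinus (φ ε : ℝ) : Set ℂ := {w | |w.im - (φ - Real.pi / 2)| < ε}

/-- The phase `φ` is admissible for `u₁, …, u_N`: `e^{-iφ}(uᵢ - uⱼ)` is never in `ℝ_{>0}`. -/
def IsAdmissible {N : ℕ} (φ : ℝ) (u : Fin N → ℂ) : Prop :=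
  ∀ i j, ∀ r : ℝ, 0 < r → Complex.exp (-(φ * Complex.I)) * (u i - u j) ≠ r

/-- `h_φ(u) = Im (e^{-iφ} u)`. -/
def height (φ : ℝ) (u : ℂ) : ℝ := (Complex.exp (-(φ * Complex.I)) * u).im

/-- Upper triangular with all diagonal entries equal to one. The Gram matrix of a
semiorthonormal collection is such. -/
def IsUniUpperTriangular {N : ℕ} (G : Matrix (Fin N) (Fin N) ℂ) : Prop :=
  (∀ i, G i i = 1) ∧ ∀ i j, j < i → G i j = 0

namespace FrobeniusManifold

variable {N : ℕ} {H : Type*} [NormedAddCommGroup H] [NormedSpace ℂ H] {B : Set H}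

/-- `Ψ₁, …, Ψ_N` are normalized idempotents of `⋆_τ`: there is a basis of orthogonal
idempotents `ψᵢ`, and `Ψᵢ = ψᵢ / √(ψᵢ, ψᵢ)` for some choices `cᵢ` of the square roots.
Such a basis exists exactly when `(H, ⋆_τ)` is semisimple. -/
def IsNormalizedIdempotents (Q : FrobeniusManifold N H B) (τ : H) (Ψ : Fin N → H) : Prop :=
  ∃ (ψ : Module.Basis (Fin N) ℂ H) (c : Fin N → ℂ),
    (∀ i j, Q.mul τ (ψ i) (ψ j) = if i = j then ψ i else 0) ∧
    (∀ i, c i ^ 2 = Q.pairing (ψ i) (ψ i)) ∧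
    ∀ i, Ψ i = (c i)⁻¹ • ψ i

/-- The big quantum connection in the direction `α`: `∇_α s = ∂_α s + z⁻¹ (α ⋆_τ s)`. -/
def nablaBase (Q : FrobeniusManifold N H B) (α : H) (s : H → ℂ → H) (τ : H) (w : ℂ) : H :=
  fderiv ℂ (fun σ => s σ w) τ α + (Complex.exp w)⁻¹ • Q.mul τ α (s τ w)

/-- The big quantum connection in the direction `z ∂_z`:
`∇_{z∂_z} s = z ∂_z s - z⁻¹ (E ⋆_τ s) + μ s`. -/
def nablaZ (Q : FrobeniusManifold N H B) (s : H → ℂ → H) (τ : H) (w : ℂ) : H :=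
  deriv (fun w' => s τ w') w
    - (Complex.exp w)⁻¹ • Q.mul τ (Q.toGradedPairedSpace.euler τ) (s τ w)
    + Q.toGradedPairedSpace.mu (s τ w)

/-- `Y = (y₁, …, y_N)` is an asymptotically exponential fundamental solution over `B`
associated to the phase `φ`, on the sector `|arg z - φ| < π / 2 + ε`: it is a holomorphic frame
of `∇`-flat sections, and `Y_τ(z) e^{U/z} → Ψ` as `z → 0` in the sector, for every `τ ∈ B`. -/
structure IsAsympExpSolution (Q : FrobeniusManifold N H B) (Ψ : Fin N → H → H)
    (u : Fin N → H → ℂ) (φ ε : ℝ) (Y : Fin N → H → ℂ → H) : Prop where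
  holomorphic : ∀ i, DifferentiableOn ℂ (fun p : H × ℂ => Y i p.1 p.2) (B ×ˢ logSector φ ε)
  flat_base : ∀ i, ∀ τ ∈ B, ∀ w ∈ logSector φ ε, ∀ α, Q.nablaBase α (Y i) τ w = 0
  flat_z : ∀ i, ∀ τ ∈ B, ∀ w ∈ logSector φ ε, Q.nablaZ (Y i) τ w = 0
  independent : ∀ τ ∈ B, ∀ w ∈ logSector φ ε, LinearIndependent ℂ fun i => Y i τ w
  asymptotic : ∀ τ ∈ B, ∀ i,
    Tendsto (fun w => Complex.exp (u i τ / Complex.exp w) • Y i τ w)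
      (comap Complex.exp (𝓝 0) ⊓ 𝓟 (logSector φ ε)) (𝓝 (Ψ i τ))

/-- The pairing `[s, t) = (s(τ, e^{-πi} z), t(τ, z))` of flat sections, evaluated at `z`. -/
def bracket (Q : FrobeniusManifold N H B) (s t : H → ℂ → H) (τ : H) (w : ℂ) : ℂ :=
  Q.pairing (s τ (w - Real.pi * Complex.I)) (t τ w)

end FrobeniusManifold

/-- `Y(z) = Y⁻(z) S` for `z ∈ Π₊`. -/
def IsStokesPlus {N : ℕ} {H : Type*} [NormedAddCommGroup H] [NormedSpace ℂ H] (φ ε : ℝ)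
    (Y Ym : Fin N → H → ℂ → H) (τ : H) (S : Matrix (Fin N) (Fin N) ℂ) : Prop :=
  ∀ w ∈ piPlus φ ε, ∀ j, Y j τ w = ∑ k, S k j • Ym k τ w

/-- `Y(z) = Y⁻(z) S₋` for `z ∈ Π₋`. The sector of `Y⁻` is centred at the phase `φ + π`, so a
point `z ∈ Π₋`, which has argument near `φ - π / 2` in the sector of `Y`, has argument
near `φ + 3π / 2` in the sector of `Y⁻`. -/
def IsStokesMinus {N : ℕ} {H : Type*} [NormedAddCommGroup H] [NormedSpace ℂ H] (φ ε : ℝ)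
    (Y Ym : Fin N → H → ℂ → H) (τ : H) (S : Matrix (Fin N) (Fin N) ℂ) : Prop :=
  ∀ w ∈ piMinus φ ε, ∀ j,
    Y j τ w = ∑ k, S k j • Ym k τ (w + 2 * Real.pi * Complex.I)

end

/-!
The pairing `(s(-z), t(z))` of two `∇`-flat sections is constant in `τ` and `z`. If `s` and `t`
behave like `e^{-uᵢ/z} Ψᵢ` and `e^{-uⱼ/z} Ψⱼ`, the constant times `e^{(uⱼ-uᵢ)/z}` tends to
`(Ψᵢ, Ψⱼ) = δᵢⱼ` as `z → 0` on the common sector. So it is `δᵢⱼ` when `uᵢ = uⱼ`, and it vanishes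
as soon as the common sector contains a ray along which the exponential blows up. For `yᵢ` and
`y⁻ⱼ` the common sector is wider than a half-plane, so there always is such a ray: the two frames
are dual, and `S` is the Gram matrix of `[yᵢ, yⱼ)`. For `yᵢ` and `yⱼ` only the ray bisecting `Π₊`
is certain to be available, and on it the exponential blows up when the height of `uᵢ` is less
than that of `uⱼ`.
-/

section Sectors

open Complex
open scoped Real

theorem isOpen_horizontalStrip (c r : ℝ) : IsOpen {w : ℂ | |w.im - c| < r} :=
  isOpen_lt (by fun_prop) continuous_const

theorem convex_horizontalStrip (c r : ℝ) : Convex ℝ {w : ℂ | |w.im - c| < r} :=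
  (convex_ball c r).linear_preimage imLm

theorem sub_pi_mul_I_mem_logSector {φ ε : ℝ} {w : ℂ} :
    w - π * I ∈ logSector φ ε ↔ w ∈ logSector (φ + π) ε := by
  simp only [logSector, Set.mem_ofPred_eq, sub_im, im_ofReal_mul, I_im, mul_one]
  rw [sub_sub, add_comm π]

theorem add_pi_mul_I_mem_logSector {φ ε : ℝ} {w : ℂ} :
    w + π * I ∈ logSector (φ + π) ε ↔ w ∈ logSector φ ε := by
  rw [← sub_pi_mul_I_mem_logSector, add_sub_cancel_right]

theorem add_pi_mul_I_mem_piPlus {φ ε : ℝ} {w : ℂ} :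
    w + π * I ∈ piPlus φ ε ↔ w ∈ piMinus φ ε := by
  simp only [piPlus, piMinus, Set.mem_ofPred_eq, add_im, im_ofReal_mul, I_im, mul_one]
  ring_nf

theorem piPlus_eq_inter (φ ε : ℝ) : piPlus φ ε = logSector (φ + π) ε ∩ logSector φ ε := by
  ext w
  have := Real.pi_pos
  simp only [piPlus, logSector, Set.mem_inter_iff, Set.mem_ofPred_eq, abs_lt]
  constructor
  · rintro ⟨_, _⟩
    refine ⟨⟨?_, ?_⟩, ?_, ?_⟩ <;> linarith
  · rintro ⟨⟨_, _⟩, _, _⟩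
    constructor <;> linarith

theorem pos_of_mem_piPlus {φ ε : ℝ} {w : ℂ} (hw : w ∈ piPlus φ ε) : 0 < ε :=
  (abs_nonneg _).trans_lt hw

theorem bisector_mem_piPlus (φ : ℝ) {ε : ℝ} (hε : 0 < ε) :
    ((φ + π / 2 : ℝ) : ℂ) * I ∈ piPlus φ ε := by
  simpa [piPlus] using hε

theorem sub_ofReal_mem_logSector {φ ε : ℝ} {w : ℂ} (hw : w ∈ logSector φ ε) (t : ℝ) :
    w - t ∈ logSector φ ε := by
  simpa [logSector] using hw

/-- In logarithmic coordinates `w - t`, `t → ∞`, runs along the ray through `exp w` to `0`. -/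
theorem tendsto_sub_ofReal_logSector {φ ε : ℝ} {w : ℂ} (hw : w ∈ logSector φ ε) :
    Tendsto (fun t : ℝ => w - t) atTop (comap exp (𝓝 0) ⊓ 𝓟 (logSector φ ε)) := by
  refine tendsto_inf.2 ⟨tendsto_comap_iff.2 (tendsto_exp_nhds_zero_iff.2 ?_),
    tendsto_principal.2 (.of_forall (sub_ofReal_mem_logSector hw))⟩
  simpa only [sub_re, ofReal_re, sub_eq_add_neg, neg_re, add_re] using
    tendsto_atBot_add_const_left _ w.re tendsto_neg_atTop_atBot

theorem re_div_exp_ofReal_mul_I (a : ℂ) (θ : ℝ) :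
    (a / exp (θ * I)).re = ‖a‖ * Real.cos (a.arg - θ) := by
  have h : a / exp (θ * I) = ‖a‖ * exp ((a.arg - θ : ℝ) * I) := by
    rw [ofReal_sub, sub_mul, exp_sub, ← mul_div_assoc, norm_mul_exp_arg_mul_I]
  rw [h, re_ofReal_mul, exp_ofReal_mul_I_re]

/-- Rotating the bisector of the sector slightly more than halfway towards the direction of `a`
brings it to within less than `π / 2` of that direction. -/
theorem exists_mem_logSector_re_div_exp_pos {a : ℂ} (ha : a ≠ 0) (φ : ℝ) {ε : ℝ} (hε : 0 < ε) :
    ∃ w ∈ logSector φ ε, 0 < (a / exp w).re := by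
  have := Real.pi_pos
  set b := a / exp (φ * I)
  have hb : 0 < ‖b‖ := norm_pos_iff.2 (div_ne_zero ha (exp_ne_zero _))
  have harg : |b.arg| ≤ π := abs_arg_le_pi b
  obtain ⟨t, ht, ht'⟩ : ∃ t : ℝ, 1 / 2 < t ∧ t < min 1 (1 / 2 + ε / π) :=
    exists_between (lt_min (by norm_num) (lt_add_of_pos_right _ (by positivity)))
  obtain ⟨ht₁, htε⟩ := lt_min_iff.1 ht'
  have hdist : |t * b.arg| < π / 2 + ε := calc
    |t * b.arg| = t * |b.arg| := by rw [abs_mul, abs_of_pos (one_half_pos.trans ht)]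
    _ ≤ t * π := by gcongr
    _ < (1 / 2 + ε / π) * π := by gcongr
    _ = π / 2 + ε := by field_simp
  have hangle : |b.arg - t * b.arg| < π / 2 := calc
    |b.arg - t * b.arg| = (1 - t) * |b.arg| := by
      rw [← one_sub_mul, abs_mul, abs_of_pos (sub_pos.2 ht₁)]
    _ ≤ (1 - t) * π := mul_le_mul_of_nonneg_left harg (sub_nonneg.2 ht₁.le)
    _ < (1 - 1 / 2) * π := by gcongr
    _ = π / 2 := by ring
  have hquot : a / exp ((φ + t * b.arg : ℝ) * I) = b / exp ((t * b.arg : ℝ) * I) := by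
    rw [div_div, ← exp_add, ← add_mul, ← ofReal_add]
  refine ⟨(φ + t * b.arg : ℝ) * I, by simpa [logSector] using hdist, ?_⟩
  rw [hquot, re_div_exp_ofReal_mul_I]
  exact mul_pos hb (Real.cos_pos_of_mem_Ioo (abs_lt.1 hangle))

end Sectors

section Asymptotics

open Complex
open scoped Real

variable {E F : Type*} [NormedAddCommGroup E] [NormedSpace ℂ E] [NormedAddCommGroup F]
  [NormedSpace ℂ F] {φ₁ φ₂ ε₁ ε₂ : ℝ} {a b : ℂ} {v : E} {v' : F} {f : ℂ → E} {g : ℂ → F} {w : ℂ}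

/-- The asymptotics `f(z) ∼ e^{-a/z} v` as `z → 0` in the sector `|arg z - φ| < π / 2 + ε`, for a
function `f` of the logarithm of `z`. -/
def IsExpAsymptotic (φ ε : ℝ) (a : ℂ) (v : E) (f : ℂ → E) : Prop :=
  Tendsto (fun w => exp (a / exp w) • f w) (comap exp (𝓝 0) ⊓ 𝓟 (logSector φ ε)) (𝓝 v)

theorem tendsto_exp_neg_div_exp_sub {c : ℂ} (hc : 0 < (c / exp w).re) :
    Tendsto (fun t : ℝ => exp (-(c / exp (w - t)))) atTop (𝓝 0) := by
  refine tendsto_exp_nhds_zero_iff.2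
    ((tendsto_neg_atTop_atBot.comp (Real.tendsto_exp_atTop.atTop_mul_const hc)).congr fun t => ?_)
  rw [exp_sub, div_div_eq_mul_div, mul_div_right_comm, mul_comm, ← ofReal_exp, Function.comp_apply,
    neg_re, re_ofReal_mul]

/-- The exponents subtract because `f` is evaluated at `e^{-πi} z = -z`. -/
theorem IsExpAsymptotic.tendsto_pairing (hf : IsExpAsymptotic φ₁ ε₁ a v f)
    (hg : IsExpAsymptotic φ₂ ε₂ b v' g) (P : E →L[ℂ] F →L[ℂ] ℂ)
    (hw₁ : w - π * I ∈ logSector φ₁ ε₁) (hw₂ : w ∈ logSector φ₂ ε₂) :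
    Tendsto (fun t : ℝ => exp ((b - a) / exp (w - t)) * P (f (w - t - π * I)) (g (w - t)))
      atTop (𝓝 (P v v')) := by
  have hP := (P.isBoundedBilinearMap.continuous.tendsto (v, v')).comp
    ((hf.comp (tendsto_sub_ofReal_logSector hw₁)).prodMk_nhds
      (hg.comp (tendsto_sub_ofReal_logSector hw₂)))
  refine hP.congr fun t => ?_
  have hexp : exp ((b - a) / exp (w - t)) =
      exp (a / exp (w - t - π * I)) * exp (b / exp (w - t)) := by
    rw [← exp_add, exp_sub_pi_mul_I, div_neg, sub_div, sub_eq_neg_add]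
  simp only [Function.comp_apply, sub_right_comm w, map_smul, smul_apply, smul_eq_mul, hexp]
  ring

variable {P : E →L[ℂ] F →L[ℂ] ℂ} {C : ℂ}

theorem IsExpAsymptotic.pairing_eq_of_const (hf : IsExpAsymptotic φ₁ ε₁ a v f)
    (hg : IsExpAsymptotic φ₂ ε₂ a v' g) (hw₁ : w - π * I ∈ logSector φ₁ ε₁)
    (hw₂ : w ∈ logSector φ₂ ε₂) (hC : ∀ t : ℝ, P (f (w - t - π * I)) (g (w - t)) = C) :
    C = P v v' := by
  have h := hf.tendsto_pairing hg P hw₁ hw₂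
  simp only [hC, sub_self, zero_div, exp_zero, one_mul] at h
  exact tendsto_nhds_unique tendsto_const_nhds h

theorem IsExpAsymptotic.pairing_eq_zero_of_const (hf : IsExpAsymptotic φ₁ ε₁ a v f)
    (hg : IsExpAsymptotic φ₂ ε₂ b v' g) (hw₁ : w - π * I ∈ logSector φ₁ ε₁)
    (hw₂ : w ∈ logSector φ₂ ε₂) (hC : ∀ t : ℝ, P (f (w - t - π * I)) (g (w - t)) = C)
    (hab : 0 < ((b - a) / exp w).re) : C = 0 := by
  have h := (tendsto_exp_neg_div_exp_sub hab).mul (hf.tendsto_pairing hg P hw₁ hw₂)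
  simp only [hC, ← mul_assoc, ← exp_add, neg_add_cancel, exp_zero, one_mul, zero_mul] at h
  exact tendsto_nhds_unique tendsto_const_nhds h

end Asymptotics

section Height

open Complex
open scoped Real

variable {φ : ℝ}

theorem re_div_exp_bisector (φ : ℝ) (a : ℂ) :
    (a / exp ((φ + π / 2 : ℝ) * I)).re = height φ a := by
  have h : exp ((φ + π / 2 : ℝ) * I) = exp (φ * I) * I := by
    rw [ofReal_add, add_mul, exp_add, ofReal_div, ofReal_ofNat, exp_pi_div_two_mul_I]
  rw [h, height, exp_neg, ← div_div, div_I, neg_re, mul_I_re, neg_neg, div_eq_inv_mul]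

theorem height_sub (φ : ℝ) (a b : ℂ) : height φ (a - b) = height φ a - height φ b := by
  rw [height, mul_sub, sub_im, height, height]

theorem IsAdmissible.eq_of_height_eq {N : ℕ} {u : Fin N → ℂ} (hφ : IsAdmissible φ u)
    {i j : Fin N} (h : height φ (u i) = height φ (u j)) : u i = u j := by
  set r := exp (-(φ * I)) * (u i - u j) with hr
  have hreal : ((r.re : ℝ) : ℂ) = r :=
    Complex.ext (ofReal_re _) ((height_sub φ _ _).trans (sub_eq_zero.2 h)).symm
  rcases lt_trichotomy r.re 0 with hneg | hzero | hpos
  · refine absurd ?_ (hφ j i (-r.re) (neg_pos.2 hneg))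
    rw [ofReal_neg, hreal]
    ring
  · rw [hzero, ofReal_zero, hr, zero_eq_mul] at hreal
    exact sub_eq_zero.1 (hreal.resolve_left (exp_ne_zero _))
  · exact absurd hreal.symm (hφ i j r.re hpos)

theorem IsAdmissible.isUniUpperTriangular_submatrix {N : ℕ} {u : Fin N → ℂ}
    (hφ : IsAdmissible φ u) {S : Matrix (Fin N) (Fin N) ℂ}
    (heq : ∀ i j, u i = u j → S i j = if i = j then 1 else 0)
    (hlt : ∀ i j, height φ (u i) < height φ (u j) → S i j = 0) {σ : Equiv.Perm (Fin N)}
    (hσ : Antitone fun k => height φ (u (σ k))) : IsUniUpperTriangular (S.submatrix σ σ) := by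
  refine ⟨fun i => (heq _ _ rfl).trans (if_pos rfl), fun i j hji => ?_⟩
  rcases (hσ hji.le).lt_or_eq with h | h
  · exact hlt _ _ h
  · exact (heq _ _ (hφ.eq_of_height_eq h)).trans (if_neg (σ.injective.ne hji.ne'))

end Height

theorem eq_sum_smul_iff_of_biorthogonal {ι R M : Type*} [Fintype ι] [DecidableEq ι]
    [CommSemiring R] [AddCommMonoid M] [Module R M] {f : ι → Module.Dual R M} {y : ι → M}
    (hy : Submodule.span R (Set.range y) = ⊤) (hfy : ∀ i k, f i (y k) = if i = k then 1 else 0)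
    (v : M) (c : ι → R) : v = ∑ k, c k • y k ↔ ∀ i, f i v = c i := by
  have hcoeff (d : ι → R) (i : ι) : f i (∑ k, d k • y k) = d i := by simp [hfy]
  refine ⟨fun h i => by rw [h, hcoeff], fun h => ?_⟩
  obtain ⟨d, rfl⟩ := (Submodule.mem_span_range_iff_exists_fun R).1 (hy ▸ Submodule.mem_top (x := v))
  exact Finset.sum_congr rfl fun k _ => by rw [← h k, hcoeff]

namespace GradedPairedSpace

variable {N : ℕ} {H : Type*} [NormedAddCommGroup H] [NormedSpace ℂ H]

theorem finiteDimensional (G : GradedPairedSpace N H) : FiniteDimensional ℂ H :=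
  Module.Finite.of_basis G.homBasis

theorem pairing_mu_left (G : GradedPairedSpace N H) (a b : H) :
    G.pairing (G.mu a) b = -G.pairing a (G.mu b) := by
  have h : G.pairing.comp G.mu LinearMap.id = -G.pairing.comp LinearMap.id G.mu := by
    refine LinearMap.BilinForm.ext_basis G.homBasis fun i j => ?_
    simp only [LinearMap.BilinForm.comp_apply, LinearMap.id_apply, LinearMap.neg_apply, mu,
      Module.Basis.constr_basis, map_smul, LinearMap.smul_apply, smul_eq_mul]
    by_cases hij : G.halfDeg i + G.halfDeg j = G.dim
    · rw [← hij]
      ring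
    · simp only [G.pairing_homogeneous i j hij, mul_zero, neg_zero]
  exact LinearMap.congr_fun₂ h a b

end GradedPairedSpace

namespace FrobeniusManifold

open scoped Real

variable {N : ℕ} {H : Type*} [NormedAddCommGroup H] [NormedSpace ℂ H] {B : Set H}
  {Q : FrobeniusManifold N H B}

theorem pairing_mul_left (Q : FrobeniusManifold N H B) {τ : H} (hτ : τ ∈ B) (a b c : H) :
    Q.pairing (Q.mul τ a b) c = Q.pairing b (Q.mul τ a c) := by
  rw [Q.mul_comm τ hτ, Q.pairing_mul τ hτ]

theorem pairing_eq_zero_of_mul_eq_zero (Q : FrobeniusManifold N H B) {τ : H} (hτ : τ ∈ B) {a b : H}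
    (ha : Q.mul τ a a = a) (hab : Q.mul τ a b = 0) : Q.pairing a b = 0 := by
  rw [← ha, Q.pairing_mul τ hτ, hab, map_zero]

theorem IsNormalizedIdempotents.pairing_eq {τ : H} (hτ : τ ∈ B) {Ψ : Fin N → H}
    (hΨ : Q.IsNormalizedIdempotents τ Ψ) (i j : Fin N) :
    Q.pairing (Ψ i) (Ψ j) = if i = j then 1 else 0 := by
  obtain ⟨ψ, c, hmul, hc, hΨ⟩ := hΨ
  have horth : Q.pairing.IsOrthoᵢ ψ := LinearMap.isOrthoᵢ_def.2 fun i j hij =>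
    Q.pairing_eq_zero_of_mul_eq_zero hτ (by rw [hmul, if_pos rfl]) (by rw [hmul, if_neg hij])
  simp only [hΨ, map_smul, LinearMap.smul_apply, smul_eq_mul]
  split_ifs with hij
  · subst hij
    have hne : Q.pairing (ψ i) (ψ i) ≠ 0 :=
      horth.not_isOrtho_basis_self_of_separatingLeft Q.pairing_nondegenerate i
    have hc₀ : c i ≠ 0 := fun h => hne (by rw [← hc, h, zero_pow two_ne_zero])
    rw [← hc]
    field_simp
  · rw [LinearMap.isOrthoᵢ_def.1 horth i j hij, mul_zero, mul_zero]

/-- A holomorphic `∇`-flat section over `B × V`, where `V` is a set of values of `log z`. -/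
structure IsFlatSection (Q : FrobeniusManifold N H B) (V : Set ℂ) (s : H → ℂ → H) : Prop where
  holomorphic : DifferentiableOn ℂ (fun p : H × ℂ => s p.1 p.2) (B ×ˢ V)
  nablaBase_eq_zero : ∀ τ ∈ B, ∀ w ∈ V, ∀ α, Q.nablaBase α s τ w = 0
  nablaZ_eq_zero : ∀ τ ∈ B, ∀ w ∈ V, Q.nablaZ s τ w = 0

section FlatSection

variable {V V₁ V₂ : Set ℂ} {s t : H → ℂ → H} {τ τ' : H} {w w' : ℂ}

theorem IsFlatSection.differentiableAt_base (hs : Q.IsFlatSection V s) (hBo : IsOpen B)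
    (hVo : IsOpen V) (hτ : τ ∈ B) (hw : w ∈ V) : DifferentiableAt ℂ (fun σ => s σ w) τ :=
  (hs.holomorphic.differentiableAt (x := (τ, w)) ((hBo.prod hVo).mem_nhds ⟨hτ, hw⟩)).comp
    (f := fun σ : H => (σ, w)) τ (by fun_prop)

theorem IsFlatSection.fderiv_base_apply (hs : Q.IsFlatSection V s) (hτ : τ ∈ B) (hw : w ∈ V)
    (α : H) :
    fderiv ℂ (fun σ => s σ w) τ α = -((Complex.exp w)⁻¹ • Q.mul τ α (s τ w)) :=
  eq_neg_of_add_eq_zero_left (hs.nablaBase_eq_zero τ hτ w hw α)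

theorem IsFlatSection.hasDerivAt (hs : Q.IsFlatSection V s) (hBo : IsOpen B) (hVo : IsOpen V)
    (hτ : τ ∈ B) (hw : w ∈ V) :
    HasDerivAt (s τ) ((Complex.exp w)⁻¹ • Q.mul τ (Q.euler τ) (s τ w) - Q.mu (s τ w)) w := by
  have hdiff : DifferentiableAt ℂ (s τ) w :=
    (hs.holomorphic.differentiableAt (x := (τ, w)) ((hBo.prod hVo).mem_nhds ⟨hτ, hw⟩)).comp
      (f := fun v : ℂ => (τ, v)) w (by fun_prop)
  have hderiv : deriv (s τ) w =
      (Complex.exp w)⁻¹ • Q.mul τ (Q.euler τ) (s τ w) - Q.mu (s τ w) := by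
    rw [← sub_eq_zero, ← sub_add]
    exact hs.nablaZ_eq_zero τ hτ w hw
  exact hderiv ▸ hdiff.hasDerivAt

theorem IsFlatSection.hasFDerivAt_bracket (hs : Q.IsFlatSection V₁ s) (ht : Q.IsFlatSection V₂ t)
    (hBo : IsOpen B) (hV₁ : IsOpen V₁) (hV₂ : IsOpen V₂) (hτ : τ ∈ B)
    (hw₁ : w - π * Complex.I ∈ V₁) (hw₂ : w ∈ V₂) :
    HasFDerivAt (fun σ => Q.bracket s t σ w) (0 : H →L[ℂ] ℂ) τ := by
  have := Q.finiteDimensional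
  refine ((LinearMap.toContinuousBilinearMap Q.pairing).hasFDerivAt_of_bilinear
    (hs.differentiableAt_base hBo hV₁ hτ hw₁).hasFDerivAt
    (ht.differentiableAt_base hBo hV₂ hτ hw₂).hasFDerivAt).congr_fderiv
    (ContinuousLinearMap.ext fun α => ?_)
  change Q.pairing (s τ (w - π * Complex.I)) (fderiv ℂ (fun σ => t σ w) τ α) +
    Q.pairing (fderiv ℂ (fun σ => s σ (w - π * Complex.I)) τ α) (t τ w) = 0
  rw [hs.fderiv_base_apply hτ hw₁, ht.fderiv_base_apply hτ hw₂, Complex.exp_sub_pi_mul_I]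
  simp only [inv_neg, map_neg, map_smul, LinearMap.neg_apply, LinearMap.smul_apply, neg_smul,
    Q.pairing_mul_left hτ]
  ring

theorem IsFlatSection.hasDerivAt_bracket (hs : Q.IsFlatSection V₁ s) (ht : Q.IsFlatSection V₂ t)
    (hBo : IsOpen B) (hV₁ : IsOpen V₁) (hV₂ : IsOpen V₂) (hτ : τ ∈ B)
    (hw₁ : w - π * Complex.I ∈ V₁) (hw₂ : w ∈ V₂) :
    HasDerivAt (fun v => Q.bracket s t τ v) 0 w := by
  have := Q.finiteDimensional
  refine ((LinearMap.toContinuousBilinearMap Q.pairing).hasDerivAt_of_bilinear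
    (fun _ => (hs.hasDerivAt hBo hV₁ hτ hw₁).comp_sub_const w (π * Complex.I))
    (fun _ => ht.hasDerivAt hBo hV₂ hτ hw₂)).congr_deriv ?_
  change Q.pairing (s τ (w - π * Complex.I)) _ + Q.pairing _ (t τ w) = 0
  rw [Complex.exp_sub_pi_mul_I]
  simp only [inv_neg, map_sub, map_smul, LinearMap.sub_apply, LinearMap.smul_apply, neg_smul,
    map_neg, LinearMap.neg_apply, Q.pairing_mul_left hτ, Q.pairing_mu_left]
  ring

theorem IsFlatSection.bracket_eq_bracket (hs : Q.IsFlatSection V₁ s) (ht : Q.IsFlatSection V₂ t)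
    (hBo : IsOpen B) (hBc : IsPreconnected B) (hV₁ : IsOpen V₁) (hV₂ : IsOpen V₂)
    (hVo : IsOpen V) (hVc : IsPreconnected V) (hVV₁ : ∀ v ∈ V, v - π * Complex.I ∈ V₁)
    (hVV₂ : V ⊆ V₂) (hτ : τ ∈ B) (hτ' : τ' ∈ B) (hw : w ∈ V) (hw' : w' ∈ V) :
    Q.bracket s t τ w = Q.bracket s t τ' w' := by
  have base (σ : H) (hσ : σ ∈ B) : HasFDerivAt (fun σ => Q.bracket s t σ w) (0 : H →L[ℂ] ℂ) σ :=
    hs.hasFDerivAt_bracket ht hBo hV₁ hV₂ hσ (hVV₁ w hw) (hVV₂ hw)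
  have fibre (v : ℂ) (hv : v ∈ V) : HasDerivAt (fun v => Q.bracket s t τ' v) 0 v :=
    hs.hasDerivAt_bracket ht hBo hV₁ hV₂ hτ' (hVV₁ v hv) (hVV₂ hv)
  calc Q.bracket s t τ w = Q.bracket s t τ' w :=
        hBo.is_const_of_fderiv_eq_zero hBc
          (fun σ hσ => (base σ hσ).differentiableAt.differentiableWithinAt)
          (fun σ hσ => (base σ hσ).fderiv) hτ hτ'
    _ = Q.bracket s t τ' w' :=
        hVo.is_const_of_deriv_eq_zero hVc
          (fun v hv => (fibre v hv).differentiableAt.differentiableWithinAt)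
          (fun v hv => (fibre v hv).deriv) hw hw'

end FlatSection

/-- The matrix of the pairings `(Xᵢ(τ, e^{-πi} z), Zⱼ(τ, z))` at `z = exp w`: for `X = Z`, the Gram
matrix of `[·, ·)`. -/
noncomputable def bracketMatrix (Q : FrobeniusManifold N H B) (X Z : Fin N → H → ℂ → H) (τ : H)
    (w : ℂ) : Matrix (Fin N) (Fin N) ℂ :=
  .of fun i j => Q.bracket (X i) (Z j) τ w

theorem bracketMatrix_eq_transpose_mul (Q : FrobeniusManifold N H B)
    {X X' : Fin N → H → ℂ → H} (Z : Fin N → H → ℂ → H) {τ : H} {w : ℂ}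
    {T : Matrix (Fin N) (Fin N) ℂ}
    (hX : ∀ j, X j τ (w - π * Complex.I) = ∑ k, T k j • X' k τ (w - π * Complex.I)) :
    Q.bracketMatrix X Z τ w = T.transpose * Q.bracketMatrix X' Z τ w := by
  ext i j
  simp [bracketMatrix, bracket, hX, Matrix.mul_apply]

namespace IsAsympExpSolution

variable {Ψ : Fin N → H → H} {u : Fin N → H → ℂ} {φ φ₁ φ₂ ε ε₁ ε₂ : ℝ}
  {X Z Y Ym : Fin N → H → ℂ → H} {τ τ' : H} {w w' : ℂ} {i j : Fin N}

theorem isFlatSection (hX : Q.IsAsympExpSolution Ψ u φ ε X) (i : Fin N) :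
    Q.IsFlatSection (logSector φ ε) (X i) :=
  ⟨hX.holomorphic i, hX.flat_base i, hX.flat_z i⟩

theorem span_eq_top (hX : Q.IsAsympExpSolution Ψ u φ ε X) (hτ : τ ∈ B) (hw : w ∈ logSector φ ε) :
    Submodule.span ℂ (Set.range fun i => X i τ w) = ⊤ := by
  have := Q.finiteDimensional
  exact (hX.independent τ hτ w hw).span_eq_top_of_card_eq_finrank'
    (Module.finrank_eq_card_basis Q.homBasis).symm

theorem bracket_eq_bracket (hX : Q.IsAsympExpSolution Ψ u φ₁ ε₁ X)
    (hZ : Q.IsAsympExpSolution Ψ u φ₂ ε₂ Z) (hBo : IsOpen B) (hBc : IsPreconnected B)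
    (hτ : τ ∈ B) (hτ' : τ' ∈ B) (hw : w ∈ logSector (φ₁ + π) ε₁ ∩ logSector φ₂ ε₂)
    (hw' : w' ∈ logSector (φ₁ + π) ε₁ ∩ logSector φ₂ ε₂) (i j : Fin N) :
    Q.bracket (X i) (Z j) τ w = Q.bracket (X i) (Z j) τ' w' :=
  (hX.isFlatSection i).bracket_eq_bracket (hZ.isFlatSection j) hBo hBc
    (isOpen_horizontalStrip _ _) (isOpen_horizontalStrip _ _)
    ((isOpen_horizontalStrip _ _).inter (isOpen_horizontalStrip _ _))
    ((convex_horizontalStrip _ _).inter (convex_horizontalStrip _ _)).isPreconnected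
    (fun _ hv => sub_pi_mul_I_mem_logSector.2 hv.1) Set.inter_subset_right hτ hτ' hw hw'

theorem bracket_sub_ofReal (hX : Q.IsAsympExpSolution Ψ u φ₁ ε₁ X)
    (hZ : Q.IsAsympExpSolution Ψ u φ₂ ε₂ Z) (hBo : IsOpen B) (hBc : IsPreconnected B)
    (hτ : τ ∈ B) (hw : w ∈ logSector (φ₁ + π) ε₁ ∩ logSector φ₂ ε₂) (i j : Fin N) (t : ℝ) :
    Q.bracket (X i) (Z j) τ (w - t) = Q.bracket (X i) (Z j) τ w :=
  hX.bracket_eq_bracket hZ hBo hBc hτ hτ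
    ⟨sub_ofReal_mem_logSector hw.1 t, sub_ofReal_mem_logSector hw.2 t⟩ hw i j

theorem bracket_eq_of_exponent_eq (hX : Q.IsAsympExpSolution Ψ u φ₁ ε₁ X)
    (hZ : Q.IsAsympExpSolution Ψ u φ₂ ε₂ Z) (hBo : IsOpen B) (hBc : IsPreconnected B)
    (hτ : τ ∈ B) (hΨ : Q.IsNormalizedIdempotents τ fun i => Ψ i τ)
    (hw : w ∈ logSector (φ₁ + π) ε₁ ∩ logSector φ₂ ε₂) (hu : u i τ = u j τ) :
    Q.bracket (X i) (Z j) τ w = if i = j then 1 else 0 := by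
  have := Q.finiteDimensional
  have hXi : IsExpAsymptotic φ₁ ε₁ (u j τ) (Ψ i τ) (X i τ) := hu ▸ hX.asymptotic τ hτ i
  rw [← hΨ.pairing_eq hτ]
  exact hXi.pairing_eq_of_const (P := LinearMap.toContinuousBilinearMap Q.pairing)
    (hZ.asymptotic τ hτ j) (sub_pi_mul_I_mem_logSector.2 hw.1) hw.2
    (hX.bracket_sub_ofReal hZ hBo hBc hτ hw i j)

theorem bracket_eq_zero_of_re_pos (hX : Q.IsAsympExpSolution Ψ u φ₁ ε₁ X)
    (hZ : Q.IsAsympExpSolution Ψ u φ₂ ε₂ Z) (hBo : IsOpen B) (hBc : IsPreconnected B)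
    (hτ : τ ∈ B) (hw : w ∈ logSector (φ₁ + π) ε₁ ∩ logSector φ₂ ε₂)
    (hu : 0 < ((u j τ - u i τ) / Complex.exp w).re) : Q.bracket (X i) (Z j) τ w = 0 := by
  have := Q.finiteDimensional
  have hXi : IsExpAsymptotic φ₁ ε₁ (u i τ) (Ψ i τ) (X i τ) := hX.asymptotic τ hτ i
  exact hXi.pairing_eq_zero_of_const (P := LinearMap.toContinuousBilinearMap Q.pairing)
    (hZ.asymptotic τ hτ j) (sub_pi_mul_I_mem_logSector.2 hw.1) hw.2
    (hX.bracket_sub_ofReal hZ hBo hBc hτ hw i j) hu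

theorem bracketMatrix_opposite (hY : Q.IsAsympExpSolution Ψ u φ ε Y)
    (hYm : Q.IsAsympExpSolution Ψ u (φ + π) ε Ym) (hBo : IsOpen B) (hBc : IsPreconnected B)
    (hε : 0 < ε) (hτ : τ ∈ B) (hΨ : Q.IsNormalizedIdempotents τ fun i => Ψ i τ)
    (hw : w ∈ logSector (φ + π) ε) : Q.bracketMatrix Y Ym τ w = 1 := by
  ext i j
  rw [Matrix.one_apply]
  by_cases hu : u i τ = u j τ
  · exact hY.bracket_eq_of_exponent_eq hYm hBo hBc hτ hΨ ⟨hw, hw⟩ hu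
  · rw [if_neg fun hij => hu (congrArg (u · τ) hij)]
    obtain ⟨v, hv, hpos⟩ :=
      exists_mem_logSector_re_div_exp_pos (sub_ne_zero.2 (Ne.symm hu)) (φ + π) hε
    exact (hY.bracket_eq_bracket hYm hBo hBc hτ hτ ⟨hw, hw⟩ ⟨hv, hv⟩ i j).trans
      (hY.bracket_eq_zero_of_re_pos hYm hBo hBc hτ ⟨hv, hv⟩ hpos)

theorem eq_sum_smul_opposite_iff (hY : Q.IsAsympExpSolution Ψ u φ ε Y)
    (hYm : Q.IsAsympExpSolution Ψ u (φ + π) ε Ym) (hBo : IsOpen B) (hBc : IsPreconnected B)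
    (hε : 0 < ε) (hτ : τ ∈ B) (hΨ : Q.IsNormalizedIdempotents τ fun i => Ψ i τ)
    (hw : w ∈ logSector (φ + π) ε) (v : H) (c : Fin N → ℂ) :
    v = ∑ k, c k • Ym k τ w ↔ ∀ i, Q.pairing (Y i τ (w - π * Complex.I)) v = c i :=
  eq_sum_smul_iff_of_biorthogonal (f := fun i => Q.pairing (Y i τ (w - π * Complex.I)))
    (hYm.span_eq_top hτ hw)
    (fun i k => (congrFun₂ (hY.bracketMatrix_opposite hYm hBo hBc hε hτ hΨ hw) i k).trans
      Matrix.one_apply) v c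

theorem bracketMatrix_eq (hY : Q.IsAsympExpSolution Ψ u φ ε Y) (hBo : IsOpen B)
    (hBc : IsPreconnected B) (hτ : τ ∈ B) (hτ' : τ' ∈ B) (hw : w ∈ piPlus φ ε)
    (hw' : w' ∈ piPlus φ ε) : Q.bracketMatrix Y Y τ w = Q.bracketMatrix Y Y τ' w' := by
  rw [piPlus_eq_inter] at hw hw'
  exact Matrix.ext (hY.bracket_eq_bracket hY hBo hBc hτ hτ' hw hw')

theorem isStokesPlus_iff (hY : Q.IsAsympExpSolution Ψ u φ ε Y)
    (hYm : Q.IsAsympExpSolution Ψ u (φ + π) ε Ym) (hBo : IsOpen B) (hBc : IsPreconnected B)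
    (hτ : τ ∈ B) (hΨ : Q.IsNormalizedIdempotents τ fun i => Ψ i τ)
    (hw : w ∈ piPlus φ ε) (T : Matrix (Fin N) (Fin N) ℂ) :
    IsStokesPlus φ ε Y Ym τ T ↔ T = Q.bracketMatrix Y Y τ w := by
  have hε := pos_of_mem_piPlus hw
  have expansion (v : ℂ) (hv : v ∈ piPlus φ ε) :
      (∀ j, Y j τ v = ∑ k, T k j • Ym k τ v) ↔ T = Q.bracketMatrix Y Y τ w := by
    rw [hY.bracketMatrix_eq hBo hBc hτ hτ hw hv, eq_comm, ← Matrix.ext_iff, forall_comm]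
    rw [piPlus_eq_inter] at hv
    exact forall_congr' fun j =>
      hY.eq_sum_smul_opposite_iff hYm hBo hBc hε hτ hΨ hv.1 _ fun k => T k j
  exact ⟨fun h => (expansion w hw).1 (h w hw), fun h v hv => (expansion v hv).2 h⟩

theorem isStokesMinus_iff (hY : Q.IsAsympExpSolution Ψ u φ ε Y)
    (hYm : Q.IsAsympExpSolution Ψ u (φ + π) ε Ym) (hBo : IsOpen B) (hBc : IsPreconnected B)
    (hτ : τ ∈ B) (hΨ : Q.IsNormalizedIdempotents τ fun i => Ψ i τ)
    (hw : w ∈ piPlus φ ε) (T : Matrix (Fin N) (Fin N) ℂ) :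
    IsStokesMinus φ ε Y Ym τ T ↔ T = (Q.bracketMatrix Y Y τ w).transpose := by
  have hε := pos_of_mem_piPlus hw
  have expansion (v : ℂ) (hv : v + π * Complex.I ∈ piPlus φ ε) :
      (∀ j, Y j τ v = ∑ k, T k j • Ym k τ (v + 2 * π * Complex.I)) ↔
        T = (Q.bracketMatrix Y Y τ w).transpose := by
    have hv₂ : v + 2 * π * Complex.I ∈ logSector (φ + π) ε := by
      rw [two_mul, add_mul, ← add_assoc, add_pi_mul_I_mem_logSector]
      exact (piPlus_eq_inter φ ε ▸ hv).2
    rw [hY.bracketMatrix_eq hBo hBc hτ hτ hw hv, eq_comm, ← Matrix.ext_iff, forall_comm]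
    refine forall_congr' fun j =>
      (hY.eq_sum_smul_opposite_iff hYm hBo hBc hε hτ hΨ hv₂ _ fun k => T k j).trans
        (forall_congr' fun i => ?_)
    have hsub : v + 2 * π * Complex.I - π * Complex.I = v + π * Complex.I := by ring
    rw [hsub, Q.pairing_symm, Matrix.transpose_apply, bracketMatrix, Matrix.of_apply, bracket,
      add_sub_cancel_right]
  constructor
  · have hw' : w - π * Complex.I + π * Complex.I ∈ piPlus φ ε := by rwa [sub_add_cancel]
    exact fun h => (expansion _ hw').1 (h _ (add_pi_mul_I_mem_piPlus.1 hw'))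
  · exact fun h v hv => (expansion v (add_pi_mul_I_mem_piPlus.2 hv)).2 h

theorem transpose_bracketMatrix_opposite_mul (hY : Q.IsAsympExpSolution Ψ u φ ε Y)
    (hYm : Q.IsAsympExpSolution Ψ u (φ + π) ε Ym) (hBo : IsOpen B) (hBc : IsPreconnected B)
    (hτ : τ ∈ B) (hΨ : Q.IsNormalizedIdempotents τ fun i => Ψ i τ) (hw : w ∈ piPlus φ ε) :
    (Q.bracketMatrix Ym Ym τ (w + π * Complex.I)).transpose * Q.bracketMatrix Y Y τ w = 1 := by
  have hstokes : IsStokesPlus φ ε Y Ym τ (Q.bracketMatrix Y Y τ w) :=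
    (hY.isStokesPlus_iff hYm hBo hBc hτ hΨ hw _).2 rfl
  have hw₂ : w + π * Complex.I ∈ logSector (φ + π) ε :=
    add_pi_mul_I_mem_logSector.2 (piPlus_eq_inter φ ε ▸ hw).2
  have hdual : (Q.bracketMatrix Y Y τ w).transpose *
      Q.bracketMatrix Ym Ym τ (w + π * Complex.I) = 1 := by
    rw [← Q.bracketMatrix_eq_transpose_mul Ym (X := Y)
      (by simpa only [add_sub_cancel_right] using hstokes w hw)]
    exact hY.bracketMatrix_opposite hYm hBo hBc (pos_of_mem_piPlus hw) hτ hΨ hw₂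
  simpa only [Matrix.transpose_mul, Matrix.transpose_transpose, Matrix.transpose_one] using
    congrArg Matrix.transpose hdual

theorem bracketMatrix_apply_of_exponent_eq (hY : Q.IsAsympExpSolution Ψ u φ ε Y) (hBo : IsOpen B)
    (hBc : IsPreconnected B) (hτ : τ ∈ B) (hΨ : Q.IsNormalizedIdempotents τ fun i => Ψ i τ)
    (hw : w ∈ piPlus φ ε) (hu : u i τ = u j τ) :
    Q.bracketMatrix Y Y τ w i j = if i = j then 1 else 0 := by
  rw [piPlus_eq_inter] at hw
  exact hY.bracket_eq_of_exponent_eq hY hBo hBc hτ hΨ hw hu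

theorem bracketMatrix_apply_of_height_lt (hY : Q.IsAsympExpSolution Ψ u φ ε Y) (hBo : IsOpen B)
    (hBc : IsPreconnected B) (hτ : τ ∈ B) (hw : w ∈ piPlus φ ε)
    (hu : height φ (u i τ) < height φ (u j τ)) : Q.bracketMatrix Y Y τ w i j = 0 := by
  have hbis := bisector_mem_piPlus φ (pos_of_mem_piPlus hw)
  rw [hY.bracketMatrix_eq hBo hBc hτ hτ hw hbis]
  rw [piPlus_eq_inter] at hbis
  refine hY.bracket_eq_zero_of_re_pos hY hBo hBc hτ hbis ?_
  rwa [re_div_exp_bisector, height_sub, sub_pos]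

end IsAsympExpSolution

end FrobeniusManifold

theorem proposition2p6 {N : ℕ} {H : Type*} [NormedAddCommGroup H] [NormedSpace ℂ H]
    {B : Set H} (hBo : IsOpen B) (hBc : IsPreconnected B)
    (Q : FrobeniusManifold N H B)
    -- normalized idempotents and eigenvalues of `E ⋆_τ`, depending holomorphically on `τ`
    (Ψ : Fin N → H → H) (u : Fin N → H → ℂ)
    (hΨ : ∀ τ ∈ B, Q.IsNormalizedIdempotents τ fun i => Ψ i τ)
    (hΨh : ∀ i, DifferentiableOn ℂ (Ψ i) B)
    (hu : ∀ τ ∈ B, ∀ i,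
      Q.mul τ (Q.toGradedPairedSpace.euler τ) (Ψ i τ) = u i τ • Ψ i τ)
    (τ₀ : H) (hτ₀ : τ₀ ∈ B) (φ : ℝ) (hφ : IsAdmissible φ fun i => u i τ₀)
    (ε : ℝ) (hε : 0 < ε)
    -- the solutions associated to `e^{iφ}` and to `-e^{iφ}`
    (Y Ym : Fin N → H → ℂ → H)
    (hY : Q.IsAsympExpSolution Ψ u φ ε Y)
    (hYm : Q.IsAsympExpSolution Ψ u (φ + Real.pi) ε Ym) :
    ∃ S Sm : Matrix (Fin N) (Fin N) ℂ,
      -- for every `τ`, `S` and `Sm` are the Stokes matrices; they do not depend on `τ`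
      (∀ τ ∈ B, ∀ T, IsStokesPlus φ ε Y Ym τ T ↔ T = S) ∧
      (∀ τ ∈ B, ∀ T, IsStokesMinus φ ε Y Ym τ T ↔ T = Sm) ∧
      -- (1)
      (∀ i j, S i j = Sm j i) ∧
      (∀ τ ∈ B, ∀ w ∈ piPlus φ ε, ∀ i j, S i j = Q.bracket (Y i) (Y j) τ w) ∧
      IsUnit S ∧
      (∀ τ ∈ B, ∀ w ∈ piPlus φ ε, ∀ i j,
        S⁻¹ i j = Q.pairing (Ym i τ (w + Real.pi * Complex.I)) (Ym j τ w)) ∧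
      -- (2)
      (∀ i, S i i = 1) ∧
      (∀ τ ∈ B, ∀ i j, i ≠ j → u i τ = u j τ → S i j = 0) ∧
      (∀ τ ∈ B, ∀ i j, height φ (u i τ) < height φ (u j τ) → S i j = 0) ∧
      -- triangularity and semiorthonormality for the orderings by decreasing height
      (∀ σ : Equiv.Perm (Fin N), Antitone (fun k => height φ (u (σ k) τ₀)) →
        IsUniUpperTriangular (S.submatrix σ σ) ∧
        ∀ τ ∈ B, ∀ w ∈ piPlus φ ε, IsUniUpperTriangular
          (Matrix.of fun k l => Q.bracket (Y (σ k)) (Y (σ l)) τ w)) := by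
  set w₀ : ℂ := ((φ + Real.pi / 2 : ℝ) : ℂ) * Complex.I
  have hw₀ : w₀ ∈ piPlus φ ε := bisector_mem_piPlus φ hε
  obtain ⟨S, hS⟩ : ∃ S, ∀ τ ∈ B, ∀ w ∈ piPlus φ ε, Q.bracketMatrix Y Y τ w = S :=
    ⟨Q.bracketMatrix Y Y τ₀ w₀, fun _ hτ _ hw => hY.bracketMatrix_eq hBo hBc hτ hτ₀ hw hw₀⟩
  have hSinv : ∀ τ ∈ B, ∀ w ∈ piPlus φ ε,
      (Q.bracketMatrix Ym Ym τ (w + Real.pi * Complex.I)).transpose * S = 1 := fun τ hτ w hw =>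
    hS τ hτ w hw ▸ hY.transpose_bracketMatrix_opposite_mul hYm hBo hBc hτ (hΨ τ hτ) hw
  have heq : ∀ τ ∈ B, ∀ i j, u i τ = u j τ → S i j = if i = j then 1 else 0 := fun τ hτ i j h =>
    hS τ hτ w₀ hw₀ ▸ hY.bracketMatrix_apply_of_exponent_eq hBo hBc hτ (hΨ τ hτ) hw₀ h
  have hlt : ∀ τ ∈ B, ∀ i j, height φ (u i τ) < height φ (u j τ) → S i j = 0 := fun τ hτ i j h =>
    hS τ hτ w₀ hw₀ ▸ hY.bracketMatrix_apply_of_height_lt hBo hBc hτ hw₀ h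
  refine ⟨S, S.transpose, fun τ hτ T => ?_, fun τ hτ T => ?_, fun _ _ => rfl,
    fun τ hτ w hw => congrFun₂ (hS τ hτ w hw).symm,
    .of_mul_eq_one_right _ (hSinv τ₀ hτ₀ w₀ hw₀), fun τ hτ w hw i j => ?_,
    fun i => (heq τ₀ hτ₀ i i rfl).trans (if_pos rfl),
    fun τ hτ i j hij h => (heq τ hτ i j h).trans (if_neg hij), hlt, fun σ hσ => ?_⟩
  · rw [← hS τ hτ w₀ hw₀, hY.isStokesPlus_iff hYm hBo hBc hτ (hΨ τ hτ) hw₀]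
  · rw [← hS τ hτ w₀ hw₀, hY.isStokesMinus_iff hYm hBo hBc hτ (hΨ τ hτ) hw₀]
  · rw [Matrix.inv_eq_left_inv (hSinv τ hτ w hw), Q.pairing_symm]
    simp [FrobeniusManifold.bracketMatrix, FrobeniusManifold.bracket]
  · have htri := hφ.isUniUpperTriangular_submatrix (heq τ₀ hτ₀) (hlt τ₀ hτ₀) hσ
    refine ⟨htri, fun τ hτ w hw => ?_⟩
    rw [← hS τ hτ w hw] at htri
    exact htri
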